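/- Let $E:\mathbb{C}\to\mathbb{C}$ be a function, put $E^\sharp(z)=\overline{E(\bar z)}$, and let $c>0$, $0<\tau\le\infty$ and $K:\mathbb{R}\to\mathbb{R}$ satisfy the following conditions. (K2) $K$ is continuous, $|K(x)|\ll e^{c|x|}$ as $|x|\to\infty$, and $E^\sharp(z)/E(z)=\int_{-\infty}^{\infty}K(x)e^{ixz}\,dx$ for $\Im z>c$ (wherever the quotient is defined). (K3) $K(x)=0$ for $x<0$. (K4) $K$ is continuously differentiable outside a discrete subset of $\mathbb{R}$, and $K'\in L^1_{\rm loc}(\mathbb{R})$. (K5) For every $0\le t<\tau$, neither $1$ nor $-1$ is an eigenvalue of the operator $\mathsf{K}[t]$ on $L^2(-\infty,t)$ given by $(\mathsf{K}[t]f)(x)=\mathbf{1}_{(-\infty,t)}(x)\int_{-\infty}^{t}K(x+y)f(y)\,dy$. For $a=\pm1$ let $$\det(1+a\,\mathsf{K}[t])=\sum_{n\ge0}\frac{a^n}{n!}\int_{(-\infty,t)^n}\det\bigl(K(x_i+x_j)\bigr)_{1\le i,j\le n}\,dx_1\cdots dx_n$$ be the Fredholm determinant. Then for every real $t<\tau$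 (so for every $t\in\mathbb{R}$ if $\tau=\infty$) the integrals and series defining $\det(1\pm\mathsf{K}[t])$ converge absolutely, $\det(1-\mathsf{K}[t])\neq0$, each of the equations $$\Phi(t,x)+\int_{-\infty}^{t}K(x+y)\Phi(t,y)\,dy=1,\qquad \Psi(t,x)-\int_{-\infty}^{t}K(x+y)\Psi(t,y)\,dy=1\qquad(x\in\mathbb{R})$$ has a unique solution $\Phi(t,\cdot)$, respectively $\Psi(t,\cdot)$, among the functions $\mathbb{R}\to\mathbb{C}$ for which the integral converges absolutely for every $x$, and $\Phi(t,t)\neq0$ and $$m(t):=\frac{\det(1+\mathsf{K}[t])}{\det(1-\mathsf{K}[t])}=\frac{1}{\Phi(t,t)}=\Psi(t,t).$$ -/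

import Mathlib

open MeasureTheory Set Filter Topology

/-- The reflection `E♯(z) = conj (E (conj z))`. -/
noncomputable def sharp (E : ℂ → ℂ) (z : ℂ) : ℂ :=
  (starRingEnd ℂ) (E ((starRingEnd ℂ) z))

/-- The Fourier integral `(F K)(z) = ∫ K(x) exp(ixz) dx` of a real-valued function `K`
at a complex point `z`. -/
noncomputable def fourierIntegralAt (K : ℝ → ℝ) (z : ℂ) : ℂ :=
  ∫ x : ℝ, (K x : ℂ) * Complex.exp (Complex.I * (x : ℂ) * z)

/-- `K` is continuous on the real line, `|K(x)| ≪ exp(c|x|)` as `|x| → ∞`, and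
`E♯(z) / E(z) = (F K)(z)` for `Im z > c`. The last identity is one between meromorphic
functions: it is required wherever the quotient is defined. -/
structure IsFourierKernel (E : ℂ → ℂ) (c : ℝ) (K : ℝ → ℝ) : Prop where
  pos : 0 < c
  continuous : Continuous K
  growth : K =O[cocompact ℝ] fun x : ℝ => Real.exp (c * |x|)
  ratio : ∀ z : ℂ, c < z.im → E z ≠ 0 → sharp E z / E z = fourierIntegralAt K z

/-- `K` vanishes on the negative real line. -/
def VanishesOnNegatives (K : ℝ → ℝ) : Prop :=
  ∀ x : ℝ, x < 0 → K x = 0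

/-- `K` is continuously differentiable outside a discrete subset `Λ` of the real line, and
`K'` (defined outside the null set `Λ`) is locally integrable. -/
def IsC1OutsideDiscrete (K : ℝ → ℝ) : Prop :=
  (∃ Λ : Set ℝ, IsDiscrete Λ ∧ (∀ x ∈ Λᶜ, DifferentiableAt ℝ K x) ∧ ContinuousOn (deriv K) Λᶜ) ∧
    LocallyIntegrable (deriv K) volume

/-- The operator `K[t] : f ↦ 1_{(-∞,t)}(x) ∫_{-∞}^t K(x+y) f(y) dy`. -/
noncomputable def truncatedOp (K : ℝ → ℝ) (t : ℝ) (f : ℝ → ℂ) : ℝ → ℂ :=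
  (Iio t).indicator fun x => ∫ y in Iio t, (K (x + y) : ℂ) * f y

/-- `a` is an eigenvalue of `K[t]` on `L²(-∞,t)`. -/
def IsEigenvalueOfTruncatedOp (K : ℝ → ℝ) (t : ℝ) (a : ℂ) : Prop :=
  ∃ f : Lp ℂ 2 (volume.restrict (Iio t)), f ≠ 0 ∧
    truncatedOp K t f =ᵐ[volume.restrict (Iio t)] fun x => a * f x

/-- `0 < τ ≤ ∞`, and neither `1` nor `-1` is an eigenvalue of `K[t]` for `0 ≤ t < τ`. -/
structure NoUnitEigenvalueBelow (K : ℝ → ℝ) (τ : EReal) : Prop where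
  pos : 0 < τ
  not_one : ∀ t : ℝ, 0 ≤ t → (t : EReal) < τ → ¬ IsEigenvalueOfTruncatedOp K t 1
  not_neg_one : ∀ t : ℝ, 0 ≤ t → (t : EReal) < τ → ¬ IsEigenvalueOfTruncatedOp K t (-1)

/-- The minor `det (k(x_i, x_j))_{1 ≤ i, j ≤ n}` of a kernel `k`. -/
def fredholmMinor (k : ℝ → ℝ → ℝ) (n : ℕ) (x : Fin n → ℝ) : ℝ :=
  (Matrix.of fun i j : Fin n => k (x i) (x j)).det

/-- The `n`-th term `(a^n / n!) ∫_{s^n} det (k(x_i, x_j)) dx_1 ⋯ dx_n` of the Fredholm series. -/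
noncomputable def fredholmTerm (k : ℝ → ℝ → ℝ) (s : Set ℝ) (a : ℝ) (n : ℕ) : ℝ :=
  a ^ n / (n.factorial : ℝ) *
    ∫ x : Fin n → ℝ in Set.pi Set.univ (fun _ => s), fredholmMinor k n x

/-- The integrals and the series that define the Fredholm determinant converge absolutely. -/
def FredholmConverges (k : ℝ → ℝ → ℝ) (s : Set ℝ) (a : ℝ) : Prop :=
  (∀ n : ℕ, IntegrableOn (fredholmMinor k n) (Set.pi Set.univ fun _ : Fin n => s) volume) ∧
    Summable (fredholmTerm k s a)

/-- The Fredholm determinant `det (1 + a T)` of the integral operator `T` on `L²(s)` with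
kernel `k`, defined by the Fredholm series. -/
noncomputable def fredholmDet (k : ℝ → ℝ → ℝ) (s : Set ℝ) (a : ℝ) : ℝ :=
  ∑' n : ℕ, fredholmTerm k s a n

/-- The kernel `(x, y) ↦ K(x + y)` of the operators `K[t]`. -/
def sumKernel (K : ℝ → ℝ) (x y : ℝ) : ℝ := K (x + y)

/-- `m(t) = det (1 + K[t]) / det (1 - K[t])`. -/
noncomputable def detRatio (K : ℝ → ℝ) (t : ℝ) : ℝ :=
  fredholmDet (sumKernel K) (Iio t) 1 / fredholmDet (sumKernel K) (Iio t) (-1)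

/-- `u` solves `u(x) + a ∫_{-∞}^t K(x+y) u(y) dy = 1` for every real `x`, the integral being
absolutely convergent. -/
def SolvesIntegralEq (K : ℝ → ℝ) (t : ℝ) (a : ℂ) (u : ℝ → ℂ) : Prop :=
  ∀ x : ℝ, IntegrableOn (fun y : ℝ => (K (x + y) : ℂ) * u y) (Iio t) volume ∧
    u x + a * ∫ y in Iio t, (K (x + y) : ℂ) * u y = 1

/-! Write `K` also for the operator `K[t]`. Since the kernel vanishes on negative arguments, only
the interval `[-t, t)` matters, and for `t ≤ 0` everything is trivial.

The heart is the identity `det (1 - K) = φ(t) det (1 + K)`, where `φ + K φ = 1`. Let `D` be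
differentiation, inverted by integration from `-t`. As the kernel depends on `x + y` only,
integration by parts gives formally `D K f = -K D f + K(· + t) f(t)`, and `f(t) = ∫ D f`. Hence `1 -
K` is similar to `1 + K - K(· + t) ⊗ 1`. By symmetry of the kernel the latter factors as `(1 - K(· +
t) ⊗ φ)(1 + K)`, and the rank one factor has determinant `1 - ∫ K(x + t) φ(x) dx = φ(t)`.

The similarity is carried out on Hankel matrices (`Matrix.det_one_sub_hankel`), with differences in
place of `D`, so that only continuity of `K` is needed. Hadamard's inequality lets matrix
determinants on finer grids converge to Fredholm determinants (`tendsto_det_one_add_gridStep`); this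
yields both `fredholmDet_neg_sumKernel` and multiplicativity (`fredholmDet_kernelMul`).

Solvability and `det (1 ± K) ≠ 0` come from the Fredholm alternative: a continuous resolvent kernel
`r` satisfies `(1 + k)(1 + r) = 1`, so the determinants multiply to `1`. Uniqueness
(`eq_zero_of_homogeneous`) is a bootstrap from integrability of `K(x + ·) D` to `D ∈ L²`. The
formula for `Ψ` is the same identity applied to `-K`. -/

/-! ### Finite determinants: principal minors, Hankel matrices, Hadamard's inequality. -/

/-- Expansion of `det (1 + A)` as a discrete Fredholm series. -/
theorem Matrix.hasSum_det_one_add {N : ℕ} (A : Matrix (Fin N) (Fin N) ℝ) :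
    HasSum (fun n : ℕ => (n.factorial : ℝ)⁻¹ * ∑ i : Fin n → Fin N, (A.submatrix i i).det)
      (1 + A).det := by
  classical
  have key : ∀ n : ℕ, ∑ i : Fin n → Fin N, (A.submatrix i i).det =
      n.factorial * ∑ S ∈ Finset.univ.powersetCard n,
        (A.submatrix (Subtype.val : {x // x ∈ S} → Fin N) Subtype.val).det := by
    intro n
    have h1 : ∑ i : Fin n → Fin N, (A.submatrix i i).det =
        ∑ i : Fin n → Fin N with Function.Injective i, (A.submatrix i i).det := by
      rw [Finset.sum_filter]
      refine Finset.sum_congr rfl fun i _ => ?_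
      split_ifs with hi
      · rfl
      · simp only [Function.Injective, not_forall] at hi
        obtain ⟨p, q, hpq, hne⟩ := hi
        exact Matrix.det_zero_of_row_eq hne (by ext j; simp [hpq])
    rw [h1, Finset.mul_sum]
    have hmaps : ∀ i ∈ (Finset.univ.filter fun i : Fin n → Fin N => Function.Injective i),
        Finset.univ.image i ∈ (Finset.univ : Finset (Fin N)).powersetCard n := by
      intro i hi
      simp only [Finset.mem_filter, Finset.mem_univ, true_and] at hi
      simp [Finset.mem_powersetCard, Finset.card_image_of_injective _ hi]
    -- Each `n`-element set `S` is the image of exactly `n!` injective tuples, all giving the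
    -- principal minor on `S`.
    rw [← Finset.sum_fiberwise_of_maps_to hmaps]
    refine Finset.sum_congr rfl fun S hS => ?_
    have hcard : S.card = n := (Finset.mem_powersetCard.mp hS).2
    have hconst : ∀ i ∈ (Finset.univ.filter fun i : Fin n → Fin N => Function.Injective i).filter
        (fun i => Finset.univ.image i = S), (A.submatrix i i).det =
        (A.submatrix (Subtype.val : S → Fin N) Subtype.val).det := by
      intro i hi
      simp only [Finset.mem_filter, Finset.mem_univ, true_and] at hi
      obtain ⟨hinj, him⟩ := hi
      have hmem : ∀ p, i p ∈ S := fun p => him ▸ Finset.mem_image_of_mem i (Finset.mem_univ p)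
      let e : Fin n ≃ S := Equiv.ofBijective (fun p => ⟨i p, hmem p⟩) <| by
        refine (Fintype.bijective_iff_injective_and_card _).mpr ⟨fun p q h => hinj ?_, ?_⟩
        · simpa using h
        · simp [hcard]
      rw [← Matrix.det_submatrix_equiv_self e]
      rfl
    rw [Finset.sum_congr rfl hconst, Finset.sum_const, nsmul_eq_mul]
    congr 1
    have : (Fintype.card (Fin n ≃ S) : ℝ) = n.factorial := by
      rw [Fintype.card_equiv (Fintype.equivOfCardEq (by simp [hcard])), Fintype.card_fin]
    rw [← this, Nat.cast_inj, ← Finset.card_univ]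
    symm
    refine Finset.card_bij (fun e _ p => (e p : Fin N)) ?_ ?_ ?_
    · intro e _
      simp only [Finset.mem_filter, Finset.mem_univ, true_and]
      refine ⟨Subtype.val_injective.comp e.injective, ?_⟩
      ext p
      simp only [Finset.mem_image, Finset.mem_univ, true_and]
      constructor
      · rintro ⟨q, rfl⟩; exact (e q).2
      · intro hp; exact ⟨e.symm ⟨p, hp⟩, by simp⟩
    · intro e _ e' _ h
      ext p
      exact congrArg Fin.val (congrFun h p)
    · intro i hi
      simp only [Finset.mem_filter, Finset.mem_univ, true_and] at hi
      obtain ⟨hinj, him⟩ := hi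
      have hmem : ∀ p, i p ∈ S := fun p => him ▸ Finset.mem_image_of_mem i (Finset.mem_univ p)
      refine ⟨Equiv.ofBijective (fun p => ⟨i p, hmem p⟩) ?_, Finset.mem_univ _, rfl⟩
      refine (Fintype.bijective_iff_injective_and_card _).mpr ⟨fun p q h => hinj ?_, ?_⟩
      · simpa using h
      · simp [hcard]
  -- The terms are the coefficients of the polynomial `det (1 + X A)`, so the series is its value at
  -- `1`.
  have hfun : (fun n : ℕ => (n.factorial : ℝ)⁻¹ * ∑ i : Fin n → Fin N, (A.submatrix i i).det) =
      fun n => (Matrix.det (1 + (Polynomial.X : Polynomial ℝ) • A.map Polynomial.C)).coeff n := by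
    funext n
    rw [key, Matrix.coeff_det_one_add_X_smul_eq_sum_minors, inv_mul_cancel_left₀ (by positivity)]
  have heval : (1 + A).det =
      (Matrix.det (1 + (Polynomial.X : Polynomial ℝ) • A.map Polynomial.C)).eval 1 := by
    rw [← Polynomial.coe_evalRingHom, RingHom.map_det]
    congr 1
    ext i j
    simp [Matrix.one_apply, apply_ite (Polynomial.eval (1 : ℝ))]
  rw [hfun, heval, Polynomial.eval_eq_sum]
  simp only [one_pow, mul_one]
  exact hasSum_sum_of_ne_finset_zero fun n hn => Polynomial.notMem_support_iff.mp hn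

/-- The determinant identity behind `det (1 - K) = det (1 + K) Φ(t)`, for Hankel matrices. -/
theorem Matrix.det_one_sub_hankel (n : ℕ) (g : ℕ → ℝ) (hg : ∀ m ≤ n, g m = 0) :
    (1 - Matrix.of fun i j : Fin (n + 1) => g (i + j)).det =
      (1 + Matrix.of fun i j : Fin (n + 1) => g (i + j + 1) - g (i + (n + 1))).det := by
  set H : Matrix (Fin (n + 1)) (Fin (n + 1)) ℝ := 1 - Matrix.of fun i j : Fin (n + 1) => g (i + j) with hH
  set M : Matrix (Fin (n + 1)) (Fin (n + 1)) ℝ :=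
    1 + Matrix.of fun i j : Fin (n + 1) => g (i + j + 1) - g (i + (n + 1)) with hM
  -- Row differences of `H`, the discrete `D (1 - K)`. Row `0` of `H` is already the unit vector
  -- because `g` vanishes up to `n`.
  let Y : Matrix (Fin (n + 1)) (Fin (n + 1)) ℝ := Matrix.of <|
    Fin.cons (fun j => if j = 0 then 1 else 0) fun i j => H i.succ j - H i.castSucc j
  -- Column `j` is the sum of columns `0, …, j` of `Y`. A row difference of `g (i + j)` is also a
  -- column difference, so the sum telescopes; the identity part changes sign, the Hankel part does
  -- not.
  let X : Matrix (Fin (n + 1)) (Fin (n + 1)) ℝ := Matrix.of <|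
    Fin.cons (fun _ => 1) fun i j => -(if i.castSucc = j then 1 else 0) - g (i + 1 + j)
  -- Subtracting the last column clears row `0` except for its last entry and creates the rank one
  -- term `g (i + (n + 1))`.
  let Z : Matrix (Fin (n + 1)) (Fin (n + 1)) ℝ := Matrix.of fun i j =>
    X i j - if j = Fin.last n then 0 else X i (Fin.last n)
  have hHY : H.det = Y.det := by
    refine Matrix.det_eq_of_forall_row_eq_smul_add_pred (fun _ => 1) (fun j => ?_) fun i j => ?_
    · have : g j = 0 := hg _ (Nat.lt_succ_iff.mp j.2)
      simp [Y, H, Matrix.one_apply, this, eq_comm]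
    · simp [Y]
  have hXY : X.det = Y.det := by
    refine Matrix.det_eq_of_forall_col_eq_smul_add_pred (fun _ => 1) (fun i => ?_) fun i j => ?_
    · refine Fin.cases ?_ (fun i => ?_) i
      · simp [X, Y]
      · have h1 : g i = 0 := hg _ i.2.le
        have h2 : g (i + 1) = 0 := hg _ i.2
        simp [X, Y, H, Matrix.one_apply, h1, h2, Fin.succ_ne_zero]
    · refine Fin.cases ?_ (fun i => ?_) i
      · simp [X, Y]
      · simp only [X, Y, H, Matrix.of_apply, Fin.cons_succ, Matrix.sub_apply, Matrix.one_apply,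
          Fin.succ_inj, Fin.val_succ, Fin.val_castSucc, Fin.castSucc_inj, one_mul]
        rw [show (i : ℕ) + ((j : ℕ) + 1) = i + 1 + j by ring]
        ring
  have hXZ : X.det = Z.det := by
    rw [← Matrix.det_transpose X, ← Matrix.det_transpose Z]
    refine Matrix.det_eq_of_forall_row_eq_smul_add_const
      (fun j => if j = Fin.last n then 0 else 1) (Fin.last n) (by simp) fun j i => ?_
    by_cases hj : j = Fin.last n <;> simp [Z, hj]
  have hZ : Z.det = (-1) ^ n * (Z.submatrix Fin.succ Fin.castSucc).det := by
    rw [Matrix.det_succ_row_zero, Finset.sum_eq_single (Fin.last n)]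
    · have : Z 0 (Fin.last n) = 1 := by simp [Z, X]
      rw [this, Fin.val_last, mul_one, Fin.succAbove_last]
    · intro j _ hj
      have : Z 0 j = 0 := by simp [Z, X, hj]
      rw [this]; ring
    · simp
  have hMdet : M.det = (M.submatrix Fin.castSucc Fin.castSucc).det := by
    rw [Matrix.det_succ_column M (Fin.last n), Finset.sum_eq_single (Fin.last n)]
    · have : M (Fin.last n) (Fin.last n) = 1 := by
        simp [M, add_assoc]
      rw [this, ← two_mul, pow_mul, Fin.succAbove_last]
      simp
    · intro i _ hi
      have : M i (Fin.last n) = 0 := by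
        simp [M, hi, add_assoc]
      rw [this]; ring
    · simp
  have hZM : Z.submatrix Fin.succ Fin.castSucc = -M.submatrix Fin.castSucc Fin.castSucc := by
    ext i j
    have h1 : Fin.castSucc j ≠ Fin.last n := (Fin.castSucc_lt_last j).ne
    have h2 : Fin.castSucc i ≠ Fin.last n := (Fin.castSucc_lt_last i).ne
    simp only [Matrix.submatrix_apply, Z, X, M, Matrix.of_apply, Fin.cons_succ, h1, h2, if_false,
      Matrix.neg_apply, Matrix.add_apply, Matrix.one_apply, Fin.val_last, Fin.val_castSucc,
      Fin.castSucc_inj]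
    rw [show (i : ℕ) + 1 + j = i + j + 1 by ring, show (i : ℕ) + 1 + n = i + (n + 1) by ring]
    ring
  rw [hHY, ← hXY, hXZ, hZ, hZM, Matrix.det_neg, hMdet, Fintype.card_fin, ← mul_assoc, ← mul_pow]
  simp

/-- Hadamard's inequality for matrices with bounded entries. -/
theorem Matrix.abs_det_le_of_abs_le {n : ℕ} (A : Matrix (Fin n) (Fin n) ℝ) {C : ℝ} (hC : 0 ≤ C)
    (hA : ∀ i j, |A i j| ≤ C) : |A.det| ≤ (C * √n) ^ n := by
  have hrow : ∀ i, ‖(WithLp.toLp 2 (A i) : EuclideanSpace ℝ (Fin n))‖ ≤ C * √n := by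
    intro i
    rw [EuclideanSpace.norm_eq]
    calc √(∑ j, ‖A i j‖ ^ 2) ≤ √(∑ _j : Fin n, C ^ 2) := by
          gcongr with j
          exact hA i j
      _ = C * √n := by
          rw [Finset.sum_const, Finset.card_univ, Fintype.card_fin, nsmul_eq_mul, mul_comm,
            Real.sqrt_mul (sq_nonneg C), Real.sqrt_sq hC]
  have : Fact (Module.finrank ℝ (EuclideanSpace ℝ (Fin n)) = n) := ⟨by simp⟩
  let b := EuclideanSpace.basisFun (Fin n) ℝ
  let o := b.toBasis.orientation
  -- Hadamard: the volume form is at most the product of the lengths of the rows.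
  have h := o.abs_volumeForm_apply_le fun i => (WithLp.toLp 2 (A i) : EuclideanSpace ℝ (Fin n))
  rw [o.volumeForm_robust b rfl] at h
  have hdet : b.toBasis.det (fun i => (WithLp.toLp 2 (A i) : EuclideanSpace ℝ (Fin n))) = A.det := by
    rw [Module.Basis.det_apply, ← Matrix.det_transpose]
    congr 1
  rw [hdet] at h
  refine h.trans ((Finset.prod_le_prod (fun i _ => norm_nonneg _) fun i _ => hrow i).trans ?_)
  simp

/-! ### Fredholm determinants of bounded kernels -/

theorem fredholmMinor_const_mul (k : ℝ → ℝ → ℝ) (a : ℝ) (n : ℕ) (x : Fin n → ℝ) :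
    fredholmMinor (fun x y => a * k x y) n x = a ^ n * fredholmMinor k n x := by
  have : (Matrix.of fun i j : Fin n => a * k (x i) (x j)) =
      a • Matrix.of fun i j : Fin n => k (x i) (x j) := by
    ext i j; simp
  rw [fredholmMinor, this, Matrix.det_smul, Fintype.card_fin, fredholmMinor]

theorem fredholmTerm_const_mul (k : ℝ → ℝ → ℝ) (s : Set ℝ) (a : ℝ) :
    fredholmTerm (fun x y => a * k x y) s 1 = fredholmTerm k s a := by
  funext n
  simp only [fredholmTerm, fredholmMinor_const_mul, integral_const_mul, one_pow]
  ring

/-- Absorbs the sign of `1 ± K[t]` into the kernel, so that the limit arguments need only the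
parameter `1`. -/
theorem fredholmDet_const_mul (k : ℝ → ℝ → ℝ) (s : Set ℝ) (a : ℝ) :
    fredholmDet (fun x y => a * k x y) s 1 = fredholmDet k s a := by
  simp only [fredholmDet, fredholmTerm_const_mul]

theorem measurable_fredholmMinor {k : ℝ → ℝ → ℝ} (hk : Measurable (Function.uncurry k)) (n : ℕ) :
    Measurable (fredholmMinor k n) := by
  unfold fredholmMinor
  simp only [Matrix.det_apply, Matrix.of_apply, Units.smul_def, zsmul_eq_mul]
  refine Finset.measurable_sum _ fun σ _ => (Finset.measurable_prod _ fun i _ => ?_).const_mul _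
  exact hk.comp (f := fun x : Fin n → ℝ => (x (σ i), x i))
    ((measurable_pi_apply _).prodMk (measurable_pi_apply _))

theorem abs_fredholmMinor_le {k : ℝ → ℝ → ℝ} {s : Set ℝ} {C : ℝ} (hC : 0 ≤ C)
    (hb : ∀ x ∈ s, ∀ y ∈ s, |k x y| ≤ C) {n : ℕ} {x : Fin n → ℝ}
    (hx : x ∈ Set.pi univ fun _ : Fin n => s) : |fredholmMinor k n x| ≤ (C * √n) ^ n :=
  Matrix.abs_det_le_of_abs_le _ hC fun i j => hb _ (hx i trivial) _ (hx j trivial)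

theorem volume_pi_const_lt_top {s : Set ℝ} (hs : volume s < ⊤) (n : ℕ) :
    volume (Set.pi univ fun _ : Fin n => s) < ⊤ := by
  rw [volume_pi_pi, Finset.prod_const]
  exact ENNReal.pow_lt_top hs

theorem volume_real_pi_const (s : Set ℝ) (n : ℕ) :
    volume.real (Set.pi univ fun _ : Fin n => s) = volume.real s ^ n := by
  simp [measureReal_def, volume_pi_pi]

theorem integrableOn_fredholmMinor {k : ℝ → ℝ → ℝ} {s : Set ℝ} {C : ℝ}
    (hk : Measurable (Function.uncurry k)) (hsm : MeasurableSet s) (hs : volume s < ⊤)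
    (hC : 0 ≤ C) (hb : ∀ x ∈ s, ∀ y ∈ s, |k x y| ≤ C) (n : ℕ) :
    IntegrableOn (fredholmMinor k n) (Set.pi univ fun _ : Fin n => s) volume :=
  IntegrableOn.of_bound (volume_pi_const_lt_top hs n)
    (measurable_fredholmMinor hk n).aestronglyMeasurable ((C * √n) ^ n) <|
    (ae_restrict_iff' (MeasurableSet.univ_pi fun _ => hsm)).mpr <|
      Eventually.of_forall fun _ hx => abs_fredholmMinor_le hC hb hx

theorem abs_fredholmTerm_le {k : ℝ → ℝ → ℝ} {s : Set ℝ} {C : ℝ}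
    (hs : volume s < ⊤) (hC : 0 ≤ C) (hb : ∀ x ∈ s, ∀ y ∈ s, |k x y| ≤ C) (n : ℕ) :
    |fredholmTerm k s 1 n| ≤ (C * volume.real s) ^ n * √n ^ n / n.factorial := by
  have h := norm_setIntegral_le_of_norm_le_const (volume_pi_const_lt_top hs n)
    (f := fredholmMinor k n) (fun x hx => abs_fredholmMinor_le hC hb hx)
  rw [volume_real_pi_const, Real.norm_eq_abs] at h
  rw [fredholmTerm, one_pow, abs_mul, abs_of_nonneg (by positivity : (0 : ℝ) ≤ 1 / n.factorial)]
  calc 1 / (n.factorial : ℝ) * _ ≤ 1 / n.factorial * ((C * √n) ^ n * volume.real s ^ n) := by gcongr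
    _ = _ := by rw [mul_pow, mul_pow]; ring

/-- From `n^n / n! ≤ e^n` the Hadamard factor `n^(n/2)` is at most `e^(n/2) √(n!)`, which leaves a
power divided by `√(n!)`. -/
theorem summable_pow_mul_sqrt_pow_div_factorial {B : ℝ} (hB : 0 ≤ B) :
    Summable fun n : ℕ => B ^ n * √n ^ n / n.factorial := by
  have key : ∀ n : ℕ, √n ^ n ≤ √(Real.exp n) * √n.factorial := by
    intro n
    rw [← Real.sqrt_mul (Real.exp_pos _).le]
    refine Real.le_sqrt_of_sq_le ?_
    rw [← pow_mul, mul_comm, pow_mul, Real.sq_sqrt n.cast_nonneg]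
    have := Real.pow_div_factorial_le_exp (n : ℝ) n.cast_nonneg n
    rwa [div_le_iff₀ (by positivity)] at this
  have hexp : ∀ n : ℕ, √(Real.exp n) = √(Real.exp 1) ^ n := by
    intro n
    rw [show Real.exp n = (√(Real.exp 1) ^ n) ^ 2 by
      rw [← pow_mul, mul_comm, pow_mul, Real.sq_sqrt (Real.exp_pos _).le, ← Real.exp_nat_mul,
        mul_one], Real.sqrt_sq (by positivity)]
  -- The `+ 1` keeps the base positive, so the ratio test also covers `B = 0`.
  have hsum : Summable fun n : ℕ => (B * √(Real.exp 1) + 1) ^ n / √n.factorial := by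
    refine summable_of_ratio_test_tendsto_lt_one (l := 0) one_pos
      (Eventually.of_forall fun n => by positivity) ?_
    have : (fun n : ℕ => ‖(B * √(Real.exp 1) + 1) ^ (n + 1) / √(n + 1).factorial‖ /
        ‖(B * √(Real.exp 1) + 1) ^ n / √n.factorial‖) =
        fun n : ℕ => (B * √(Real.exp 1) + 1) / √((n + 1 : ℕ) : ℝ) := by
      funext n
      rw [Real.norm_of_nonneg (by positivity), Real.norm_of_nonneg (by positivity),
        Nat.factorial_succ, Nat.cast_mul, Real.sqrt_mul (by positivity), pow_succ]
      have : (0 : ℝ) < √n.factorial := by positivity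
      field_simp
    rw [this]
    refine Tendsto.const_div_atTop ?_ _
    exact Real.tendsto_sqrt_atTop.comp
      (tendsto_natCast_atTop_atTop.comp (tendsto_add_atTop_nat 1))
  refine Summable.of_nonneg_of_le (fun n => by positivity) (fun n => ?_) hsum
  have hf : (0 : ℝ) < √n.factorial := by positivity
  calc B ^ n * √n ^ n / n.factorial
      ≤ B ^ n * (√(Real.exp 1) ^ n * √n.factorial) / n.factorial := by
        have := key n
        rw [hexp] at this
        gcongr
    _ = (B * √(Real.exp 1)) ^ n / √n.factorial := by
        have h2 : (n.factorial : ℝ) = √n.factorial * √n.factorial :=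
          (Real.mul_self_sqrt (by positivity)).symm
        rw [mul_pow, div_eq_div_iff (by positivity) hf.ne']
        conv_rhs => rw [h2]
        ring
    _ ≤ _ := by gcongr; linarith

theorem summable_fredholmTerm {k : ℝ → ℝ → ℝ} {s : Set ℝ} {C : ℝ}
    (hs : volume s < ⊤) (hC : 0 ≤ C) (hb : ∀ x ∈ s, ∀ y ∈ s, |k x y| ≤ C) :
    Summable (fredholmTerm k s 1) :=
  Summable.of_norm_bounded (summable_pow_mul_sqrt_pow_div_factorial (by positivity))
    (abs_fredholmTerm_le hs hC hb)

/-- The Fredholm determinant is continuous under bounded pointwise convergence of kernels. -/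
theorem tendsto_fredholmDet {k : ℝ → ℝ → ℝ} {l : ℕ → ℝ → ℝ → ℝ} {s : Set ℝ} {C : ℝ}
    (hl : ∀ N, Measurable (Function.uncurry (l N))) (hsm : MeasurableSet s) (hs : volume s < ⊤)
    (hC : 0 ≤ C) (hb : ∀ N, ∀ x ∈ s, ∀ y ∈ s, |l N x y| ≤ C)
    (hlim : ∀ x ∈ s, ∀ y ∈ s, Tendsto (fun N => l N x y) atTop (𝓝 (k x y))) :
    Tendsto (fun N => fredholmDet (l N) s 1) atTop (𝓝 (fredholmDet k s 1)) := by
  refine tendsto_tsum_of_dominated_convergence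
    (summable_pow_mul_sqrt_pow_div_factorial (B := C * volume.real s) (by positivity)) (fun n => ?_)
    (Eventually.of_forall fun N n => abs_fredholmTerm_le hs hC (hb N) n)
  refine Tendsto.const_mul _ ?_
  have hpi : MeasurableSet (Set.pi univ fun _ : Fin n => s) := MeasurableSet.univ_pi fun _ => hsm
  refine tendsto_integral_of_dominated_convergence (fun _ => (C * √n) ^ n)
    (fun N => (measurable_fredholmMinor (hl N) n).aestronglyMeasurable)
    (integrableOn_const (volume_pi_const_lt_top hs n).ne)
    (fun N => (ae_restrict_iff' hpi).mpr <|
      Eventually.of_forall fun _ hx => abs_fredholmMinor_le hC (hb N) hx)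
    ((ae_restrict_iff' hpi).mpr <| Eventually.of_forall fun x hx => ?_)
  have hdet : Continuous fun M : Matrix (Fin n) (Fin n) ℝ => M.det := continuous_id.matrix_det
  refine (hdet.tendsto _).comp ?_
  refine tendsto_pi_nhds.mpr fun i => tendsto_pi_nhds.mpr fun j => ?_
  exact hlim _ (hx i trivial) _ (hx j trivial)

/-- The Fredholm determinant of a step kernel is a matrix determinant. -/
theorem fredholmDet_step {N : ℕ} (A : Matrix (Fin N) (Fin N) ℝ) {s : Set ℝ} {h : ℝ}
    {q : ℝ → Fin N} (hq : Measurable q) (hs : volume s < ⊤)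
    (hqs : ∀ i, (volume.restrict s).real (q ⁻¹' {i}) = h) :
    fredholmDet (fun x y => A (q x) (q y)) s 1 = (1 + h • A).det := by
  have : IsFiniteMeasure (volume.restrict s) := ⟨by simpa using hs⟩
  refine HasSum.tsum_eq ?_
  convert (h • A).hasSum_det_one_add using 1
  funext n
  rw [fredholmTerm, one_pow, one_div]
  congr 1
  -- Pushing forward along `q` gives every index mass `h`, so the integral becomes a sum over index
  -- tuples with weight `h ^ n`.
  have hmap : Measure.map (fun (x : Fin n → ℝ) i => q (x i))
      (volume.restrict (Set.pi univ fun _ : Fin n => s)) =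
      Measure.pi fun _ : Fin n => Measure.map q (volume.restrict s) := by
    rw [volume_pi, Measure.restrict_pi_pi]
    exact Measure.pi_map_pi fun _ => hq.aemeasurable
  have hfun : fredholmMinor (fun x y => A (q x) (q y)) n =
      fun x => (fun i : Fin n → Fin N => (A.submatrix i i).det) fun p => q (x p) := rfl
  have hqm : Measurable fun (x : Fin n → ℝ) i => q (x i) :=
    measurable_pi_lambda _ fun i => hq.comp (measurable_pi_apply i)
  rw [hfun, ← integral_map (φ := fun (x : Fin n → ℝ) i => q (x i)) hqm.aemeasurable
    (Measurable.of_discrete).aestronglyMeasurable, hmap,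
    integral_fintype Integrable.of_finite]
  refine Finset.sum_congr rfl fun i _ => ?_
  have h1 : (h • A).submatrix i i = h • A.submatrix i i := rfl
  rw [h1, Matrix.det_smul, Fintype.card_fin, smul_eq_mul]
  congr 1
  rw [measureReal_def, Measure.pi_singleton, ENNReal.toReal_prod]
  have : ∀ p, (Measure.map q (volume.restrict s) {i p}).toReal = h := by
    intro p
    rw [Measure.map_apply hq (measurableSet_singleton _)]
    exact hqs _
  simp [this]

/-! ### Discretization on a uniform grid -/

/-- The mesh of the uniform grid with `N + 1` cells on `[a, b)`. -/
noncomputable def gridStep (a b : ℝ) (N : ℕ) : ℝ := (b - a) / (N + 1)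

/-- The left end points of the cells of the uniform grid on `[a, b)`. -/
noncomputable def gridPoint (a b : ℝ) (N : ℕ) (i : Fin (N + 1)) : ℝ := a + i * gridStep a b N

/-- The index of the cell of the uniform grid that contains `x`. -/
noncomputable def gridIndex (a b : ℝ) (N : ℕ) (x : ℝ) : Fin (N + 1) :=
  ⟨min N ⌊(x - a) / gridStep a b N⌋₊, Nat.lt_succ_of_le (min_le_left _ _)⟩

section Grid

variable {a b : ℝ} (N : ℕ)

theorem gridStep_pos (hab : a < b) : 0 < gridStep a b N :=
  div_pos (sub_pos.mpr hab) (by positivity)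

theorem succ_mul_gridStep (a b : ℝ) : (N + 1 : ℝ) * gridStep a b N = b - a := by
  unfold gridStep; field_simp

theorem tendsto_gridStep (a b : ℝ) : Tendsto (gridStep a b) atTop (𝓝 0) := by
  refine Tendsto.const_div_atTop ?_ _
  exact tendsto_atTop_add_const_right _ _ tendsto_natCast_atTop_atTop

theorem measurable_gridIndex (a b : ℝ) : Measurable (gridIndex a b N) := by
  have h1 : Measurable fun x : ℝ => ⌊(x - a) / gridStep a b N⌋₊ :=
    Nat.measurable_floor.comp ((measurable_id.sub_const a).div_const _)
  exact (Measurable.of_discrete (f := fun m : ℕ =>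
    (⟨min N m, Nat.lt_succ_of_le (min_le_left _ _)⟩ : Fin (N + 1)))).comp h1

/-- On `[a, b)` the floor is at most `N`, so the truncation by `min` in `gridIndex` has no effect.
-/
theorem gridIndex_eq_iff (hab : a < b) {x : ℝ} (hx : x ∈ Ico a b) (i : Fin (N + 1)) :
    gridIndex a b N x = i ↔
      gridPoint a b N i ≤ x ∧ x < gridPoint a b N i + gridStep a b N := by
  have hh := gridStep_pos N hab
  have h0 : 0 ≤ (x - a) / gridStep a b N := div_nonneg (sub_nonneg.mpr hx.1) hh.le
  have hlt : ⌊(x - a) / gridStep a b N⌋₊ < N + 1 := by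
    rw [Nat.floor_lt h0, div_lt_iff₀ hh]
    push_cast
    rw [succ_mul_gridStep]
    linarith [hx.2]
  rw [Fin.ext_iff, gridIndex, Fin.val_mk, min_eq_right (Nat.lt_succ_iff.mp hlt),
    Nat.floor_eq_iff h0, le_div_iff₀ hh, div_lt_iff₀ hh, gridPoint]
  constructor <;> rintro ⟨h1, h2⟩ <;> constructor <;> linarith

theorem gridPoint_gridIndex_le (hab : a < b) {x : ℝ} (hx : x ∈ Ico a b) :
    gridPoint a b N (gridIndex a b N x) ≤ x :=
  ((gridIndex_eq_iff N hab hx _).mp rfl).1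

theorem lt_gridPoint_gridIndex_add (hab : a < b) {x : ℝ} (hx : x ∈ Ico a b) :
    x < gridPoint a b N (gridIndex a b N x) + gridStep a b N :=
  ((gridIndex_eq_iff N hab hx _).mp rfl).2

theorem gridPoint_add_le (hab : a < b) (i : Fin (N + 1)) :
    gridPoint a b N i + gridStep a b N ≤ b := by
  have hh := gridStep_pos N hab
  have hi : ((i : ℕ) : ℝ) ≤ N := by exact_mod_cast Nat.lt_succ_iff.mp i.2
  have := succ_mul_gridStep N a b
  unfold gridPoint
  nlinarith

theorem le_gridPoint (hab : a < b) (i : Fin (N + 1)) : a ≤ gridPoint a b N i := by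
  have hh := gridStep_pos N hab
  unfold gridPoint
  have : 0 ≤ ((i : ℕ) : ℝ) * gridStep a b N := by positivity
  linarith

theorem gridPoint_mem_Icc (hab : a < b) (i : Fin (N + 1)) : gridPoint a b N i ∈ Icc a b :=
  ⟨le_gridPoint N hab i, by linarith [gridPoint_add_le N hab i, gridStep_pos N hab]⟩

theorem measureReal_gridIndex_preimage (hab : a < b) (i : Fin (N + 1)) :
    (volume.restrict (Ico a b)).real (gridIndex a b N ⁻¹' {i}) = gridStep a b N := by
  have hh := gridStep_pos N hab
  rw [measureReal_restrict_apply (measurable_gridIndex N a b (measurableSet_singleton i))]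
  have : gridIndex a b N ⁻¹' {i} ∩ Ico a b =
      Ico (gridPoint a b N i) (gridPoint a b N i + gridStep a b N) := by
    ext x
    simp only [mem_inter_iff, mem_preimage, mem_singleton_iff]
    constructor
    · rintro ⟨h1, h2⟩
      exact (gridIndex_eq_iff N hab h2 i).mp h1
    · intro h
      have hx : x ∈ Ico a b :=
        ⟨(le_gridPoint N hab i).trans h.1, h.2.trans_le (gridPoint_add_le N hab i)⟩
      exact ⟨(gridIndex_eq_iff N hab hx i).mpr h, hx⟩
  rw [this, Real.volume_real_Ico, add_sub_cancel_left, max_eq_left hh.le]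

theorem tendsto_gridPoint_gridIndex (hab : a < b) {x : ℝ} (hx : x ∈ Ico a b) :
    Tendsto (fun N => gridPoint a b N (gridIndex a b N x)) atTop (𝓝 x) := by
  refine tendsto_of_tendsto_of_tendsto_of_le_of_le (g := fun N => x - gridStep a b N) ?_
    tendsto_const_nhds (fun N => ?_) fun N => gridPoint_gridIndex_le N hab hx
  · simpa using tendsto_const_nhds.sub (tendsto_gridStep a b)
  · linarith [lt_gridPoint_gridIndex_add N hab hx]

theorem integral_comp_gridIndex (hab : a < b) (f : Fin (N + 1) → ℝ) :
    ∫ z in Ico a b, f (gridIndex a b N z) = gridStep a b N * ∑ i, f i := by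
  have hq := measurable_gridIndex N a b
  have : IsFiniteMeasure (Measure.map (gridIndex a b N) (volume.restrict (Ico a b))) :=
    inferInstance
  rw [← integral_map hq.aemeasurable Measurable.of_discrete.aestronglyMeasurable,
    integral_fintype Integrable.of_finite, Finset.mul_sum]
  refine Finset.sum_congr rfl fun i _ => ?_
  rw [map_measureReal_apply hq (measurableSet_singleton i),
    measureReal_gridIndex_preimage N hab i, smul_eq_mul]

end Grid

/-- Matrix determinants over finer and finer grids converge to the Fredholm determinant. -/
theorem tendsto_det_one_add_gridStep {a b C : ℝ} (hab : a < b) (hC : 0 ≤ C) {k : ℝ → ℝ → ℝ}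
    (A : ∀ N : ℕ, Matrix (Fin (N + 1)) (Fin (N + 1)) ℝ) (hb : ∀ N i j, |A N i j| ≤ C)
    (hlim : ∀ x ∈ Ico a b, ∀ y ∈ Ico a b,
      Tendsto (fun N => A N (gridIndex a b N x) (gridIndex a b N y)) atTop (𝓝 (k x y))) :
    Tendsto (fun N => (1 + gridStep a b N • A N).det) atTop
      (𝓝 (fredholmDet k (Ico a b) 1)) := by
  have hv : volume (Ico a b) < ⊤ := by simp
  have h := tendsto_fredholmDet (k := k)
    (l := fun N x y => A N (gridIndex a b N x) (gridIndex a b N y))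
    (fun N => ?_) measurableSet_Ico hv hC (fun N x _ y _ => hb N _ _) hlim
  · refine h.congr fun N => ?_
    exact fredholmDet_step (A N) (measurable_gridIndex N a b) hv
      (measureReal_gridIndex_preimage N hab)
  · have hq := measurable_gridIndex N a b
    exact (Measurable.of_discrete (f := fun p : Fin (N + 1) × Fin (N + 1) => A N p.1 p.2)).comp
      ((hq.comp measurable_fst).prodMk (hq.comp measurable_snd))

theorem exists_bound_on_Icc {k : ℝ → ℝ → ℝ} (hk : Continuous (Function.uncurry k)) (a b : ℝ) :
    ∃ C, 0 ≤ C ∧ ∀ x ∈ Icc a b, ∀ y ∈ Icc a b, |k x y| ≤ C := by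
  obtain ⟨C, hC⟩ := (isCompact_Icc.prod isCompact_Icc).exists_bound_of_continuousOn
    (s := Icc a b ×ˢ Icc a b) hk.continuousOn
  exact ⟨max C 0, le_max_right _ _, fun x hx y hy => (hC (x, y) ⟨hx, hy⟩).trans (le_max_left _ _)⟩

/-! ### Determinant identities: multiplicativity, the Hankel identity in the limit, rank one
kernels. -/

/-- The kernel of `(1 + k)(1 + l) - 1`, for integral operators on `[a, b)`. -/
noncomputable def kernelMul (a b : ℝ) (k l : ℝ → ℝ → ℝ) (x y : ℝ) : ℝ :=
  k x y + l x y + ∫ z in Ico a b, k x z * l z y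

/-- Fredholm determinants are multiplicative. -/
theorem fredholmDet_kernelMul {a b : ℝ} (hab : a < b) {k l : ℝ → ℝ → ℝ}
    (hk : Continuous (Function.uncurry k)) (hl : Continuous (Function.uncurry l)) :
    fredholmDet (kernelMul a b k l) (Ico a b) 1 =
      fredholmDet k (Ico a b) 1 * fredholmDet l (Ico a b) 1 := by
  obtain ⟨C, hC, hkC⟩ := exists_bound_on_Icc hk a b
  obtain ⟨D, hD, hlD⟩ := exists_bound_on_Icc hl a b
  let A : ∀ N : ℕ, Matrix (Fin (N + 1)) (Fin (N + 1)) ℝ := fun N =>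
    Matrix.of fun i j => k (gridPoint a b N i) (gridPoint a b N j)
  let B : ∀ N : ℕ, Matrix (Fin (N + 1)) (Fin (N + 1)) ℝ := fun N =>
    Matrix.of fun i j => l (gridPoint a b N i) (gridPoint a b N j)
  have hg := fun N => gridPoint_mem_Icc (a := a) (b := b) N hab
  have hlimk : ∀ x ∈ Ico a b, ∀ y ∈ Ico a b,
      Tendsto (fun N => A N (gridIndex a b N x) (gridIndex a b N y)) atTop (𝓝 (k x y)) :=
    fun x hx y hy => (hk.tendsto (x, y)).comp
      ((tendsto_gridPoint_gridIndex hab hx).prodMk_nhds (tendsto_gridPoint_gridIndex hab hy))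
  have hliml : ∀ x ∈ Ico a b, ∀ y ∈ Ico a b,
      Tendsto (fun N => B N (gridIndex a b N x) (gridIndex a b N y)) atTop (𝓝 (l x y)) :=
    fun x hx y hy => (hl.tendsto (x, y)).comp
      ((tendsto_gridPoint_gridIndex hab hx).prodMk_nhds (tendsto_gridPoint_gridIndex hab hy))
  have hA := tendsto_det_one_add_gridStep hab hC A (fun N i j => hkC _ (hg N i) _ (hg N j)) hlimk
  have hB := tendsto_det_one_add_gridStep hab hD B (fun N i j => hlD _ (hg N i) _ (hg N j)) hliml
  -- This matrix comes from `(1 + h A)(1 + h B) = 1 + h (A + B + h A B)`; the sum in `h A B` is the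
  -- integral of a step function.
  have hentry : ∀ N (i j : Fin (N + 1)), (A N + B N + gridStep a b N • (A N * B N)) i j =
      A N i j + B N i j +
        ∫ z in Ico a b, A N i (gridIndex a b N z) * B N (gridIndex a b N z) j := by
    intro N i j
    rw [integral_comp_gridIndex N hab fun m => A N i m * B N m j]
    simp [Matrix.mul_apply]
  have hfin : volume (Ico a b) < ⊤ := by simp
  have hAB := tendsto_det_one_add_gridStep hab (k := kernelMul a b k l)
    (C := C + D + C * D * (b - a)) (by have := sub_pos.mpr hab; positivity)
    (fun N => A N + B N + gridStep a b N • (A N * B N)) (fun N i j => ?_) fun x hx y hy => ?_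
  · refine tendsto_nhds_unique hAB ((hA.mul hB).congr fun N => ?_)
    rw [← Matrix.det_mul]
    congr 1
    simp only [mul_add, add_mul, mul_one, one_mul, Matrix.smul_mul, Matrix.mul_smul]
    module
  · rw [hentry]
    have hint : |∫ z in Ico a b, A N i (gridIndex a b N z) * B N (gridIndex a b N z) j| ≤
        C * D * (b - a) := by
      have := norm_setIntegral_le_of_norm_le_const (μ := volume) hfin (C := C * D)
        (f := fun z => A N i (gridIndex a b N z) * B N (gridIndex a b N z) j) fun z _ => by
          rw [Real.norm_eq_abs, abs_mul]
          exact mul_le_mul (hkC _ (hg N _) _ (hg N _)) (hlD _ (hg N _) _ (hg N _))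
            (abs_nonneg _) hC
      rwa [Real.volume_real_Ico, max_eq_left (sub_pos.mpr hab).le] at this
    have h1 : |A N i j| ≤ C := hkC _ (hg N i) _ (hg N j)
    have h2 : |B N i j| ≤ D := hlD _ (hg N i) _ (hg N j)
    exact (abs_add_le _ _).trans (add_le_add ((abs_add_le _ _).trans (add_le_add h1 h2)) hint)
  · simp only [hentry]
    refine ((hlimk x hx y hy).add (hliml x hx y hy)).add ?_
    refine tendsto_integral_of_dominated_convergence (fun _ => C * D) (fun N => ?_)
      (integrableOn_const hfin.ne) (fun N => Eventually.of_forall fun z => ?_)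
      ((ae_restrict_iff' measurableSet_Ico).mpr <| Eventually.of_forall fun z hz => ?_)
    · exact ((Measurable.of_discrete (f := fun m => A N (gridIndex a b N x) m *
        B N m (gridIndex a b N y))).comp (measurable_gridIndex N a b)).aestronglyMeasurable
    · rw [Real.norm_eq_abs, abs_mul]
      exact mul_le_mul (hkC _ (hg N _) _ (hg N _)) (hlD _ (hg N _) _ (hg N _)) (abs_nonneg _) hC
    · exact (hlimk x hx z hz).mul (hliml z hz y hy)

/-- For a continuous `K` supported on `[0, ∞)`, the determinant of `1 - K[t]` equals that of the
operator with kernel `K(x + y) - K(x + t)`, a rank one perturbation of `1 + K[t]`. -/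
theorem fredholmDet_neg_sumKernel {K : ℝ → ℝ} (hK : Continuous K) (hK0 : ∀ x ≤ 0, K x = 0)
    {t : ℝ} (ht : 0 < t) :
    fredholmDet (fun x y => -K (x + y)) (Ico (-t) t) 1 =
      fredholmDet (fun x y => K (x + y) - K (x + t)) (Ico (-t) t) 1 := by
  have hab : -t < t := by linarith
  obtain ⟨C, hC⟩ := (isCompact_Icc (a := -(2 * t)) (b := 2 * t)).exists_bound_of_continuousOn
    hK.continuousOn
  have hC0 : 0 ≤ C := (norm_nonneg _).trans (hC 0 ⟨by linarith, by linarith⟩)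
  have hg := fun N => gridPoint_mem_Icc (a := -t) (b := t) N hab
  have h1 := tendsto_det_one_add_gridStep hab hC0 (k := fun x y => -K (x + y))
    (fun N => Matrix.of fun i j => -K (gridPoint (-t) t N i + gridPoint (-t) t N j))
    (fun N i j => ?_) fun x hx y hy => ?_
  · have h2 := tendsto_det_one_add_gridStep hab (C := C + C) (by positivity)
      (k := fun x y => K (x + y) - K (x + t))
      (fun N => Matrix.of fun i j =>
        K (gridPoint (-t) t N i + gridPoint (-t) t N j + gridStep (-t) t N) -
          K (gridPoint (-t) t N i + t))
      (fun N i j => ?_) fun x hx y hy => ?_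
    · refine tendsto_nhds_unique h1 (h2.congr fun N => ?_)
      have hh := gridStep_pos N hab
      have hN := succ_mul_gridStep N (-t) t
      -- With mesh `h`, index `m ≤ N` is the argument `-2t + m h < 0`, where `K` vanishes; index `N
      -- + 1` is the argument `0`.
      have := Matrix.det_one_sub_hankel N
        (fun m => gridStep (-t) t N * K (-(2 * t) + m * gridStep (-t) t N)) fun m hm => by
          have hm' : (m : ℝ) ≤ N := by exact_mod_cast hm
          rw [hK0 _ (by nlinarith), mul_zero]
      convert this.symm using 3
      · ext i j
        simp only [Matrix.smul_apply, Matrix.of_apply, smul_eq_mul, gridPoint]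
        rw [mul_sub]
        congr 3
        · push_cast; ring
        · push_cast; linear_combination -hN
      · rw [sub_eq_add_neg]
        congr 1
        ext i j
        simp only [Matrix.smul_apply, Matrix.of_apply, Matrix.neg_apply, smul_eq_mul, gridPoint]
        rw [mul_neg]
        congr 3
        push_cast; ring
    · obtain ⟨hi1, hi2⟩ := hg N i
      obtain ⟨hj1, hj2⟩ := hg N j
      have hj3 := gridPoint_add_le N hab j
      have hh := gridStep_pos N hab
      exact (abs_sub _ _).trans (add_le_add (hC _ ⟨by linarith, by linarith⟩)
        (hC _ ⟨by linarith, by linarith⟩))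
    · have hx' := tendsto_gridPoint_gridIndex hab hx
      have hy' := tendsto_gridPoint_gridIndex hab hy
      refine Tendsto.sub ((hK.tendsto _).comp ?_) ((hK.tendsto _).comp (hx'.add_const t))
      simpa using (hx'.add hy').add (tendsto_gridStep (-t) t)
  · obtain ⟨hi1, hi2⟩ := hg N i
    obtain ⟨hj1, hj2⟩ := hg N j
    rw [Matrix.of_apply, abs_neg]
    exact hC _ ⟨by linarith, by linarith⟩
  · exact ((hK.tendsto _).comp ((tendsto_gridPoint_gridIndex hab hx).add
      (tendsto_gridPoint_gridIndex hab hy))).neg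

/-- The Fredholm determinant of a rank one kernel. -/
theorem fredholmDet_rank_one (u v : ℝ → ℝ) (s : Set ℝ) :
    fredholmDet (fun x y => u x * v y) s 1 = 1 + ∫ x in s, u x * v x := by
  have hterm : ∀ n ∉ Finset.range 2, fredholmTerm (fun x y => u x * v y) s 1 n = 0 := by
    intro n hn
    have hn2 : 2 ≤ n := by simpa [Nat.succ_le_iff] using hn
    have : fredholmMinor (fun x y => u x * v y) n = fun _ => 0 := by
      funext x
      have h01 : (⟨0, by omega⟩ : Fin n) ≠ ⟨1, by omega⟩ := by simp
      let w : Fin n → ℝ := fun j => v (x j)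
      have hM : (Matrix.of fun i j : Fin n => u (x i) * v (x j)) =
          Matrix.vecMulVec (fun i => u (x i)) w := rfl
      have : Nontrivial (Fin n) := ⟨_, _, h01⟩
      rw [fredholmMinor, hM, Matrix.det_vecMulVec]
    simp [fredholmTerm, this]
  rw [fredholmDet, tsum_eq_sum hterm, Finset.sum_range_succ, Finset.sum_range_one]
  congr 1
  · simp [fredholmTerm, fredholmMinor, measureReal_def, volume_pi_pi]
  · have h := (volume_preserving_funUnique (Fin 1) ℝ).setIntegral_preimage_emb
      (MeasurableEquiv.measurableEmbedding _) (fun x => u x * v x) s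
    have hs : MeasurableEquiv.funUnique (Fin 1) ℝ ⁻¹' s = Set.pi univ fun _ => s := by
      ext x
      simp [MeasurableEquiv.funUnique, Subsingleton.elim _ (0 : Fin 1)]
    rw [hs] at h
    rw [← h]
    simp [fredholmTerm, fredholmMinor, MeasurableEquiv.funUnique]
    rfl

/-! ### Integral operators with continuous kernels -/

section IntegralOperator

variable {a b : ℝ} {k : ℝ → ℝ → ℝ}

theorem continuous_integral_kernel_mul (hk : Continuous (Function.uncurry k)) {f : ℝ → ℝ}
    (hf : Continuous f) : Continuous fun x => ∫ z in Ico a b, k x z * f z := by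
  simp only [← integral_Icc_eq_integral_Ico]
  exact continuous_parametric_integral_of_continuous
    (hk.mul (hf.comp continuous_snd)) isCompact_Icc

theorem abs_integral_kernel_mul_le (hab : a < b) {u f : ℝ → ℝ} {C D : ℝ} (hC : 0 ≤ C)
    (hu : ∀ z ∈ Ico a b, |u z| ≤ C) (hf : ∀ z ∈ Ico a b, |f z| ≤ D) :
    |∫ z in Ico a b, u z * f z| ≤ C * D * (b - a) := by
  have := norm_setIntegral_le_of_norm_le_const (μ := volume) (s := Ico a b) (by simp) (C := C * D)
    (f := fun z => u z * f z) fun z hz => by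
      rw [Real.norm_eq_abs, abs_mul]
      exact mul_le_mul (hu z hz) (hf z hz) (abs_nonneg _) hC
  rwa [Real.volume_real_Ico, max_eq_left (sub_pos.mpr hab).le] at this

theorem integrableOn_kernel_mul (hk : Continuous (Function.uncurry k)) {f : ℝ → ℝ}
    (hf : Continuous f) (x : ℝ) : IntegrableOn (fun z => k x z * f z) (Ico a b) :=
  ((hk.comp (Continuous.prodMk_right x)).mul hf).continuousOn.integrableOn_Icc.mono_set
    Ico_subset_Icc_self

theorem continuous_comp_projIcc (hab : a < b) (f : BoundedContinuousFunction (Icc a b) ℝ) :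
    Continuous fun z => f (projIcc a b hab.le z) :=
  f.continuous.comp continuous_projIcc

/-- The integral operator with continuous kernel `k` on bounded continuous functions on
`[a, b]`. -/
noncomputable def integralOp (hab : a < b) (hk : Continuous (Function.uncurry k)) :
    BoundedContinuousFunction (Icc a b) ℝ →ₗ[ℝ] BoundedContinuousFunction (Icc a b) ℝ where
  toFun f := BoundedContinuousFunction.mkOfCompact
    ⟨fun x => ∫ z in Ico a b, k x z * f (projIcc a b hab.le z),
      (continuous_integral_kernel_mul hk (continuous_comp_projIcc hab f)).comp
        continuous_subtype_val⟩
  map_add' f g := by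
    ext x
    simp only [BoundedContinuousFunction.mkOfCompact_apply, ContinuousMap.coe_mk,
      BoundedContinuousFunction.add_apply, mul_add]
    exact integral_add (integrableOn_kernel_mul hk (continuous_comp_projIcc hab f) _)
      (integrableOn_kernel_mul hk (continuous_comp_projIcc hab g) _)
  map_smul' c f := by
    ext x
    simp only [BoundedContinuousFunction.mkOfCompact_apply, ContinuousMap.coe_mk,
      BoundedContinuousFunction.smul_apply, smul_eq_mul, RingHom.id_apply]
    rw [← integral_const_mul]
    congr 1
    funext z
    ring

theorem integralOp_apply (hab : a < b) (hk : Continuous (Function.uncurry k))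
    (f : BoundedContinuousFunction (Icc a b) ℝ) (x : Icc a b) :
    integralOp hab hk f x = ∫ z in Ico a b, k x z * f (projIcc a b hab.le z) := rfl

/-- Arzelà–Ascoli: the image of the unit ball is uniformly bounded, and `∫ |k x z - k x₀ z| dz` is a
common modulus of continuity at `x₀`. -/
theorem isCompactOperator_integralOp (hab : a < b) (hk : Continuous (Function.uncurry k)) :
    IsCompactOperator (integralOp hab hk) := by
  rw [isCompactOperator_iff_exists_mem_nhds_isCompact_closure_image]
  refine ⟨Metric.ball 0 1, Metric.ball_mem_nhds _ one_pos, ?_⟩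
  obtain ⟨C, hC, hkC⟩ := exists_bound_on_Icc hk a b
  have hball : ∀ f ∈ Metric.ball (0 : BoundedContinuousFunction (Icc a b) ℝ) 1,
      ∀ z, |f (projIcc a b hab.le z)| ≤ 1 := fun f hf z =>
    (f.norm_coe_le_norm _).trans (mem_ball_zero_iff.mp hf).le
  refine BoundedContinuousFunction.arzela_ascoli (Metric.closedBall 0 (C * 1 * (b - a)))
    (isCompact_closedBall _ _) _ ?_ ?_
  · rintro _ x ⟨f, hf, rfl⟩
    rw [mem_closedBall_zero_iff, Real.norm_eq_abs, integralOp_apply]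
    exact abs_integral_kernel_mul_le hab hC
      (fun z hz => hkC _ x.2 _ (Ico_subset_Icc_self hz)) fun z _ => hball f hf z
  · intro x₀
    let G : ℝ → ℝ := fun x => ∫ z in Ico a b, |k x z - k x₀ z| * 1
    have hcont : Continuous (Function.uncurry fun x z => |k x z - k x₀ z|) :=
      (hk.sub (hk.comp (continuous_const.prodMk continuous_snd))).abs
    have hG : Continuous G := continuous_integral_kernel_mul hcont continuous_const
    refine Metric.equicontinuousAt_of_continuity_modulus (fun x : Icc a b => G x) ?_ _ ?_
    · have := (hG.comp continuous_subtype_val).tendsto x₀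
      simpa [G, Function.comp_def] using this
    · refine Eventually.of_forall fun x => ?_
      rintro ⟨_, f, hf, rfl⟩
      have hi := fun y => integrableOn_kernel_mul (a := a) (b := b) hk
        (continuous_comp_projIcc hab f) y
      rw [dist_comm, Real.dist_eq]
      simp only [integralOp_apply]
      rw [← integral_sub (hi x) (hi x₀)]
      rw [← Real.norm_eq_abs]
      refine norm_integral_le_of_norm_le (integrableOn_kernel_mul hcont continuous_const _)
        (Eventually.of_forall fun z => ?_)
      rw [← sub_mul, Real.norm_eq_abs, abs_mul]
      exact mul_le_mul_of_nonneg_left (hball f hf z) (abs_nonneg _)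

/-- The Fredholm alternative for integral operators with continuous kernels. -/
theorem exists_integralOp_rightInverse (hab : a < b) (hk : Continuous (Function.uncurry k))
    (hinj : ∀ f : ℝ → ℝ, Continuous f →
      (∀ x ∈ Icc a b, f x + ∫ z in Ico a b, k x z * f z = 0) → ∀ x ∈ Icc a b, f x = 0) :
    ∃ S : BoundedContinuousFunction (Icc a b) ℝ →L[ℝ] BoundedContinuousFunction (Icc a b) ℝ,
      ∀ g, S g + integralOp hab hk (S g) = g := by
  have hcomp := isCompactOperator_integralOp hab hk
  let T := ContinuousLinearMap.mkOfIsCompactOperator hcomp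
  have hT : IsCompactOperator T := hcomp
  rcases hT.hasEigenvalue_or_mem_resolventSet (μ := (-1 : ℝ)) (by norm_num) with h | h
  · exfalso
    obtain ⟨f, hf⟩ := h.exists_hasEigenvector
    refine hf.2 ?_
    have hTf : integralOp hab hk f = (-1 : ℝ) • f := hf.apply_eq_smul
    ext x
    have := hinj (fun z => f (projIcc a b hab.le z)) (continuous_comp_projIcc hab f)
      (fun y hy => ?_) x x.2
    · simpa using this
    · have := DFunLike.congr_fun hTf ⟨y, hy⟩
      rw [integralOp_apply] at this
      rw [this, projIcc_of_mem hab.le hy]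
      simp
  · rw [spectrum.mem_resolventSet_iff] at h
    obtain ⟨u, hu⟩ := h
    -- Here `u = -1 - T`, so `-u⁻¹` inverts `1 + T`.
    refine ⟨-(↑u⁻¹ : BoundedContinuousFunction (Icc a b) ℝ →L[ℝ] _), fun g => ?_⟩
    have h1 := DFunLike.congr_fun u.mul_inv g
    rw [hu] at h1
    have h2 : -u⁻¹.1 g - T (u⁻¹.1 g) = g := by
      simpa [Algebra.algebraMap_eq_smul_one] using h1
    have h3 : integralOp hab hk ((-u⁻¹.1) g) = -T (u⁻¹.1 g) := by
      rw [_root_.neg_apply, map_neg]; rfl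
    rw [h3, _root_.neg_apply]
    rw [← sub_eq_add_neg]
    exact h2

theorem fredholmDet_congr {k l : ℝ → ℝ → ℝ} {s : Set ℝ} (hs : MeasurableSet s)
    (h : ∀ x ∈ s, ∀ y ∈ s, k x y = l x y) (c : ℝ) : fredholmDet k s c = fredholmDet l s c := by
  unfold fredholmDet fredholmTerm
  congr 1
  funext n
  congr 1
  refine setIntegral_congr_fun (MeasurableSet.univ_pi fun _ => hs) fun x hx => ?_
  unfold fredholmMinor
  congr 1
  ext i j
  exact h _ (hx i trivial) _ (hx j trivial)

theorem fredholmDet_zero (s : Set ℝ) : fredholmDet (fun _ _ => 0) s 1 = 1 := by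
  simpa using fredholmDet_rank_one (fun _ => 0) (fun _ => 0) s

/-- If `1 + T` is injective for the integral operator `T` with continuous kernel `k`, then the
Fredholm determinant does not vanish and `φ + T φ = 1` has a continuous solution. -/
theorem fredholmDet_ne_zero_and_exists_solution (hab : a < b)
    (hk : Continuous (Function.uncurry k))
    (hinj : ∀ f : ℝ → ℝ, Continuous f →
      (∀ x ∈ Icc a b, f x + ∫ z in Ico a b, k x z * f z = 0) → ∀ x ∈ Icc a b, f x = 0) :
    fredholmDet k (Ico a b) 1 ≠ 0 ∧
      ∃ φ : ℝ → ℝ, Continuous φ ∧ ∀ x ∈ Icc a b, φ x + ∫ z in Ico a b, k x z * φ z = 1 := by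
  obtain ⟨S, hS⟩ := exists_integralOp_rightInverse hab hk hinj
  constructor
  -- The arguments are swapped so that currying gives the continuous family `y ↦ k(·, y)`. Then `R y
  -- = -(1 + T)⁻¹ k(·, y)` is the resolvent kernel, jointly continuous, and `kernelMul a b k r`
  -- vanishes on the square.
  · let c : C(Icc a b × Icc a b, ℝ) := ⟨fun p => k p.2 p.1,
      hk.comp ((continuous_subtype_val.comp continuous_snd).prodMk
        (continuous_subtype_val.comp continuous_fst))⟩
    let R : Icc a b → BoundedContinuousFunction (Icc a b) ℝ := fun y =>
      -S (ContinuousMap.isometryEquivBoundedOfCompact (Icc a b) ℝ (c.curry y))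
    have hR : Continuous R := (S.continuous.comp
      ((ContinuousMap.isometryEquivBoundedOfCompact (Icc a b) ℝ).continuous.comp
        c.curry.continuous)).neg
    let r : ℝ → ℝ → ℝ := fun x y => R (projIcc a b hab.le y) (projIcc a b hab.le x)
    have hr : Continuous (Function.uncurry r) := by
      have h1 : Continuous fun p : ℝ × ℝ =>
          (R (projIcc a b hab.le p.2), projIcc a b hab.le p.1) :=
        (hR.comp (continuous_projIcc.comp continuous_snd)).prodMk
          (continuous_projIcc.comp continuous_fst)
      exact continuous_eval.comp h1
    have hkr := fredholmDet_kernelMul hab hk hr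
    have hzero : fredholmDet (kernelMul a b k r) (Ico a b) 1 = 1 := by
      refine Eq.trans ?_ (fredholmDet_zero (Ico a b))
      refine fredholmDet_congr measurableSet_Ico (fun x hx y hy => ?_) 1
      have hx' := Ico_subset_Icc_self hx
      have hy' := Ico_subset_Icc_self hy
      have h := DFunLike.congr_fun (hS (ContinuousMap.isometryEquivBoundedOfCompact (Icc a b) ℝ
        (c.curry ⟨y, hy'⟩))) ⟨x, hx'⟩
      have h2 : integralOp hab hk (R ⟨y, hy'⟩) ⟨x, hx'⟩ = ∫ z in Ico a b, k x z * r z y := by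
        rw [integralOp_apply]
        simp only [r, projIcc_of_mem hab.le hy']
      have h3 : r x y = R ⟨y, hy'⟩ ⟨x, hx'⟩ := by
        simp only [r, projIcc_of_mem hab.le hy', projIcc_of_mem hab.le hx']
      rw [kernelMul, ← h2, h3]
      simp only [R, map_neg, BoundedContinuousFunction.neg_apply]
      have h4 : (ContinuousMap.isometryEquivBoundedOfCompact (Icc a b) ℝ
        (c.curry ⟨y, hy'⟩)) ⟨x, hx'⟩ = k x y := rfl
      rw [BoundedContinuousFunction.add_apply, h4] at h
      linarith
    intro h0
    rw [h0, zero_mul, hzero] at hkr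
    exact one_ne_zero hkr
  · refine ⟨fun x => S (BoundedContinuousFunction.const _ 1) (projIcc a b hab.le x),
      continuous_comp_projIcc hab _, fun x hx => ?_⟩
    have h := DFunLike.congr_fun (hS (BoundedContinuousFunction.const _ 1)) ⟨x, hx⟩
    rw [BoundedContinuousFunction.add_apply, integralOp_apply] at h
    beta_reduce
    rw [projIcc_of_mem hab.le hx]
    exact h

end IntegralOperator

/-! ### The kernel `K(x + y)` on `(-∞, t)` -/

section SumKernel

variable {K : ℝ → ℝ} {t : ℝ}

theorem VanishesOnNegatives.eq_zero_of_nonpos (h : VanishesOnNegatives K) (hK : Continuous K)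
    {x : ℝ} (hx : x ≤ 0) : K x = 0 := by
  have hcl : IsClosed {x | K x = 0} := isClosed_eq hK continuous_const
  have hsub : closure (Iio (0 : ℝ)) ⊆ {x | K x = 0} := hcl.closure_subset_iff.mpr fun x hx => h x hx
  rw [closure_Iio] at hsub
  exact hsub hx

/-- If some `x i < -t` while all `x j < t`, then every `x i + x j` is negative and row `i` is zero.
This cuts `(-∞, t)` down to `[-t, t)`. -/
theorem fredholmMinor_sumKernel_eq_zero (h : VanishesOnNegatives K) {n : ℕ} {x : Fin n → ℝ}
    (hx : x ∈ (Set.pi univ fun _ : Fin n => Iio t) \ Set.pi univ fun _ => Ico (-t) t) :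
    fredholmMinor (sumKernel K) n x = 0 := by
  obtain ⟨h1, h2⟩ := hx
  simp only [mem_univ_pi, mem_Iio, mem_Ico, not_forall, not_and_or] at h1 h2
  obtain ⟨i, hi⟩ := h2
  refine Matrix.det_eq_zero_of_row_eq_zero i fun j => h _ ?_
  rcases hi with hi | hi
  · linarith [h1 j, not_le.mp hi]
  · exact absurd (h1 i) hi

theorem fredholmTerm_sumKernel_Iio (h : VanishesOnNegatives K) (a : ℝ) :
    fredholmTerm (sumKernel K) (Iio t) a = fredholmTerm (sumKernel K) (Ico (-t) t) a := by
  funext n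
  unfold fredholmTerm
  rw [setIntegral_eq_of_subset_of_forall_sdiff_eq_zero
    (MeasurableSet.univ_pi fun _ => measurableSet_Iio)
    (Set.pi_mono fun _ _ => Ico_subset_Iio_self) fun x hx => fredholmMinor_sumKernel_eq_zero h hx]

theorem fredholmDet_sumKernel_Iio (h : VanishesOnNegatives K) (a : ℝ) :
    fredholmDet (sumKernel K) (Iio t) a =
      fredholmDet (fun x y => a * K (x + y)) (Ico (-t) t) 1 := by
  have := fredholmDet_const_mul (sumKernel K) (Ico (-t) t) a
  rw [fredholmDet, fredholmTerm_sumKernel_Iio h]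
  exact this.symm

theorem continuous_uncurry_add (hK : Continuous K) :
    Continuous (Function.uncurry fun x y => K (x + y)) :=
  hK.comp (continuous_fst.add continuous_snd)

theorem fredholmConverges_sumKernel (hK : Continuous K) (h : VanishesOnNegatives K) (a : ℝ) :
    FredholmConverges (sumKernel K) (Iio t) a := by
  have hc := continuous_uncurry_add hK
  constructor
  · intro n
    obtain ⟨C, hC, hb⟩ := exists_bound_on_Icc hc (-t) t
    refine IntegrableOn.of_forall_sdiff_eq_zero ?_
      (MeasurableSet.univ_pi fun _ => measurableSet_Iio)
      fun x hx => fredholmMinor_sumKernel_eq_zero h hx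
    exact integrableOn_fredholmMinor hc.measurable measurableSet_Ico (by simp) hC
      (fun x hx y hy => hb x (Ico_subset_Icc_self hx) y (Ico_subset_Icc_self hy)) n
  · have hca : Continuous (Function.uncurry fun x y => a * K (x + y)) := continuous_const.mul hc
    obtain ⟨C, hC, hb⟩ := exists_bound_on_Icc hca (-t) t
    rw [fredholmTerm_sumKernel_Iio h]
    have := summable_fredholmTerm (k := fun x y => a * K (x + y)) (s := Ico (-t) t) (by simp) hC
      fun x hx y hy => hb x (Ico_subset_Icc_self hx) y (Ico_subset_Icc_self hy)
    rwa [show (fun x y => a * K (x + y)) = fun x y => a * sumKernel K x y from rfl,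
      fredholmTerm_const_mul] at this

theorem setIntegral_Iio_eq (h : VanishesOnNegatives K) {x : ℝ} (hx : x ≤ t) (u : ℝ → ℂ) :
    ∫ y in Iio t, (K (x + y) : ℂ) * u y = ∫ y in Ico (-t) t, (K (x + y) : ℂ) * u y := by
  refine setIntegral_eq_of_subset_of_forall_sdiff_eq_zero measurableSet_Iio Ico_subset_Iio_self
    fun y hy => ?_
  have : y < -t := by
    by_contra hc
    exact hy.2 ⟨not_lt.mp hc, hy.1⟩
  rw [h (x + y) (by linarith)]
  simp

theorem setIntegral_Iio_eq_zero (h : VanishesOnNegatives K) {x : ℝ} (hx : x ≤ -t) (u : ℝ → ℂ) :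
    ∫ y in Iio t, (K (x + y) : ℂ) * u y = 0 := by
  refine setIntegral_eq_zero_of_forall_eq_zero fun y hy => ?_
  have hy' : y < t := hy
  rw [h (x + y) (by linarith)]
  simp

theorem integrableOn_Iio_kernel_mul (hK : Continuous K) (h : VanishesOnNegatives K) {u : ℝ → ℂ}
    (x : ℝ) (hu : IntegrableOn u (Icc (-x) t)) :
    IntegrableOn (fun y => (K (x + y) : ℂ) * u y) (Iio t) := by
  have h1 : IntegrableOn (fun y => (K (x + y) : ℂ) * u y) (Icc (-x) t) :=
    hu.continuousOn_mul (by fun_prop) isCompact_Icc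
  refine (h1.of_forall_sdiff_eq_zero measurableSet_Iic fun y hy => ?_).mono_set Iio_subset_Iic_self
  have : y < -x := by
    by_contra hc
    exact hy.2 ⟨not_lt.mp hc, hy.1⟩
  rw [h (x + y) (by linarith)]
  simp

/-- An `L²` solution of the homogeneous equation vanishes if `-a` is not an eigenvalue. -/
theorem ae_eq_zero_of_not_isEigenvalue {a : ℂ} (ha : a * a = 1)
    (hn : ¬ IsEigenvalueOfTruncatedOp K t (-a)) {w : ℝ → ℂ}
    (hw : MemLp w 2 (volume.restrict (Iio t)))
    (heq : ∀ x < t, w x + a * ∫ y in Iio t, (K (x + y) : ℂ) * w y = 0) :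
    w =ᵐ[volume.restrict (Iio t)] 0 := by
  by_contra hne
  refine hn ⟨hw.toLp w, fun h0 => hne ?_, ?_⟩
  · rw [Lp.ext_iff] at h0
    exact hw.coeFn_toLp.symm.trans (h0.trans (Lp.coeFn_zero _ _ _))
  · filter_upwards [hw.coeFn_toLp, ae_restrict_mem measurableSet_Iio] with x hx hxt
    have hint : ∫ y in Iio t, (K (x + y) : ℂ) * (hw.toLp w) y =
        ∫ y in Iio t, (K (x + y) : ℂ) * w y := by
      refine integral_congr_ae ?_
      filter_upwards [hw.coeFn_toLp] with y hy
      rw [hy]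
    rw [truncatedOp, indicator_of_mem hxt, hint, hx]
    have := heq x hxt
    linear_combination a * this - (∫ y in Iio t, (K (x + y) : ℂ) * w y) * ha

/-- For `t ≤ 0` all `x + y` are negative and `K[t] = 0`. This supplies the range `t < 0`, about
which `NoUnitEigenvalueBelow` says nothing. -/
theorem not_isEigenvalueOfTruncatedOp_of_neg (h : VanishesOnNegatives K) (ht : t ≤ 0) {a : ℂ}
    (ha : a ≠ 0) : ¬ IsEigenvalueOfTruncatedOp K t a := by
  rintro ⟨f, hf, heq⟩
  refine hf (Lp.ext ?_)
  filter_upwards [heq, Lp.coeFn_zero ℂ 2 (volume.restrict (Iio t)),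
    ae_restrict_mem measurableSet_Iio] with x hx h0 hxt
  have hxt' : x < t := hxt
  rw [truncatedOp, indicator_of_mem hxt, setIntegral_Iio_eq_zero h (by linarith)] at hx
  rw [h0]
  exact (mul_eq_zero.mp hx.symm).resolve_left ha

/-- Injectivity of `1 + a K[t]` on real continuous functions. -/
theorem eq_zero_of_continuous_of_not_isEigenvalue (h : VanishesOnNegatives K) (ht : 0 < t)
    {a : ℝ} (ha : a * a = 1) (hn : ¬ IsEigenvalueOfTruncatedOp K t (-(a : ℂ))) (f : ℝ → ℝ)
    (hf : Continuous f)
    (heq : ∀ x ∈ Icc (-t) t, f x + ∫ z in Ico (-t) t, a * K (x + z) * f z = 0) :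
    ∀ x ∈ Icc (-t) t, f x = 0 := by
  -- Extension by zero solves the equation below `-t` too, where the integral vanishes.
  let w : ℝ → ℂ := (Ico (-t) t).indicator fun x => (f x : ℂ)
  obtain ⟨B, hB⟩ := isCompact_Icc.exists_bound_of_continuousOn (s := Icc (-t) t) hf.continuousOn
  have hw : MemLp w 2 volume := by
    rw [memLp_indicator_iff_restrict measurableSet_Ico]
    refine MemLp.of_bound (Complex.continuous_ofReal.comp hf).aestronglyMeasurable B ?_
    filter_upwards [ae_restrict_mem measurableSet_Ico] with x hx
    simpa using hB x (Ico_subset_Icc_self hx)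
  have hzero := ae_eq_zero_of_not_isEigenvalue (by exact_mod_cast ha) hn (hw.restrict _)
    fun x hx => ?_
  · have h1 : f =ᵐ[volume.restrict (Icc (-t) t)] fun _ => 0 := by
      rw [← Measure.restrict_congr_set (Ico_ae_eq_Icc (μ := volume) (a := -t) (b := t))]
      have h2 := ae_restrict_of_ae_restrict_of_subset (Ico_subset_Iio_self (a := -t)) hzero
      filter_upwards [h2, ae_restrict_mem measurableSet_Ico] with x hx hxm
      simpa [w, indicator_of_mem hxm] using hx
    exact Measure.eqOn_Icc_of_ae_eq volume (by linarith : (-t : ℝ) ≠ t) h1 hf.continuousOn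
      continuousOn_const
  · by_cases hxt : x < -t
    · rw [setIntegral_Iio_eq_zero h hxt.le, mul_zero, add_zero]
      exact indicator_of_notMem (fun hm => not_lt.mpr hm.1 hxt) _
    · have hxm : x ∈ Ico (-t) t := ⟨not_lt.mp hxt, hx⟩
      rw [setIntegral_Iio_eq h hx.le, setIntegral_congr_fun (g := fun y => ((K (x + y) * f y : ℝ) : ℂ))
        measurableSet_Ico fun y hy => ?_, integral_complex_ofReal]
      · have := heq x (Ico_subset_Icc_self hxm)
        simp only [mul_assoc] at this
        rw [integral_const_mul] at this
        simp only [w, indicator_of_mem hxm]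
        exact_mod_cast this
      · simp [w, indicator_of_mem hy]

/-- The homogeneous equation has only the zero solution, without any regularity assumption. -/
theorem eq_zero_of_homogeneous (hK : Continuous K) (h : VanishesOnNegatives K) {a : ℂ}
    (ha : a * a = 1) (hn : ¬ IsEigenvalueOfTruncatedOp K t (-a)) {D : ℝ → ℂ}
    (hint : ∀ x, IntegrableOn (fun y => (K (x + y) : ℂ) * D y) (Iio t))
    (heq : ∀ x, D x + a * ∫ y in Iio t, (K (x + y) : ℂ) * D y = 0) : D = 0 := by
  by_cases hKz : ∃ p, K p ≠ 0
  swap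
  · push Not at hKz
    funext x
    simpa [hKz] using heq x
  obtain ⟨p, hp⟩ := hKz
  -- Near `y₀`, take `x = p - y₀` in `hint` and divide by `K (x + y)`, which stays away from zero
  -- because `K p ≠ 0`.
  have hloc : LocallyIntegrable ((Iio t).indicator D) volume := by
    intro y₀
    have hcont : Continuous fun y => (K (p - y₀ + y) : ℂ) := by fun_prop
    have hne : ∀ᶠ y in 𝓝 y₀, (K (p - y₀ + y) : ℂ) ≠ 0 :=
      hcont.continuousAt.eventually_ne (by simpa using hp)
    obtain ⟨δ, hδ, hball⟩ := Metric.nhds_basis_closedBall.mem_iff.mp hne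
    refine ⟨Metric.closedBall y₀ δ, Metric.closedBall_mem_nhds _ hδ, ?_⟩
    rw [IntegrableOn, integrable_indicator_iff measurableSet_Iio, IntegrableOn,
      Measure.restrict_restrict measurableSet_Iio]
    have h1 := ((hint (p - y₀)).mono_set (inter_subset_left (t := Metric.closedBall y₀ δ)))
    have h2 : ContinuousOn (fun y => (K (p - y₀ + y) : ℂ)⁻¹) (Metric.closedBall y₀ δ) :=
      hcont.continuousOn.inv₀ fun y hy => hball hy
    have h3 := h1.continuousOn_mul_of_subset h2 (isCompact_closedBall _ _)
      (measurableSet_Iio.inter Metric.isClosed_closedBall.measurableSet) inter_subset_right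
    refine (integrableOn_congr_fun (fun y hy => ?_) (measurableSet_Iio.inter
      Metric.isClosed_closedBall.measurableSet)).mp h3
    exact inv_mul_cancel_left₀ (hball hy.2) _
  have hIcc : IntegrableOn ((Iio t).indicator D) (Icc (-t) t) :=
    hloc.integrableOn_isCompact isCompact_Icc
  obtain ⟨C, hC0, hC⟩ := exists_bound_on_Icc (continuous_uncurry_add hK) (-t) t
  have hDneg : ∀ x ≤ -t, D x = 0 := fun x hx => by
    simpa [setIntegral_Iio_eq_zero h hx] using heq x
  have hna : ‖a‖ = 1 := by
    have : ‖a‖ * ‖a‖ = 1 := by rw [← norm_mul, ha, norm_one]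
    nlinarith [norm_nonneg a]
  -- The equation bounds `D` by its own `L¹` norm on `[-t, t)`, so `D` is bounded there and hence in
  -- `L²`.
  have hbound : ∀ x ∈ Ico (-t) t, ‖(Iio t).indicator D x‖ ≤
      ∫ y in Ico (-t) t, C * ‖(Iio t).indicator D y‖ := by
    intro x hx
    have hxt : x ∈ Iio t := hx.2
    rw [indicator_of_mem hxt, eq_neg_of_add_eq_zero_left (heq x), norm_neg, norm_mul, hna, one_mul,
      setIntegral_Iio_eq h hx.2.le]
    refine norm_integral_le_of_norm_le ((hIcc.mono_set Ico_subset_Icc_self).norm.const_mul C) ?_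
    filter_upwards [ae_restrict_mem measurableSet_Ico] with y hy
    have hyt : y ∈ Iio t := hy.2
    rw [indicator_of_mem hyt, norm_mul, Complex.norm_real]
    exact mul_le_mul_of_nonneg_right
      (hC x (Ico_subset_Icc_self hx) y (Ico_subset_Icc_self hy)) (norm_nonneg _)
  have hmem : MemLp ((Ico (-t) t).indicator ((Iio t).indicator D)) 2 volume := by
    rw [memLp_indicator_iff_restrict measurableSet_Ico]
    refine MemLp.of_bound hloc.aestronglyMeasurable.restrict
      (∫ y in Ico (-t) t, C * ‖(Iio t).indicator D y‖) ?_
    filter_upwards [ae_restrict_mem measurableSet_Ico] with x hx using hbound x hx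
  have hD : MemLp D 2 (volume.restrict (Iio t)) := by
    refine (hmem.restrict (Iio t)).ae_eq ?_
    filter_upwards [ae_restrict_mem measurableSet_Iio] with x hx
    by_cases hxt : -t ≤ x
    · have hx' : x ∈ Ico (-t) t := ⟨hxt, hx⟩
      rw [indicator_of_mem hx', indicator_of_mem hx]
    · rw [indicator_of_notMem fun hm => hxt hm.1, hDneg x (not_le.mp hxt).le]
  have hzero := ae_eq_zero_of_not_isEigenvalue ha hn hD fun x _ => heq x
  funext x
  have : ∫ y in Iio t, (K (x + y) : ℂ) * D y = 0 := by
    refine integral_eq_zero_of_ae ?_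
    filter_upwards [hzero] with y hy
    simp [hy]
  simpa [this] using heq x

theorem SolvesIntegralEq.unique (hK : Continuous K) (h : VanishesOnNegatives K) {a : ℂ}
    (ha : a * a = 1) (hn : ¬ IsEigenvalueOfTruncatedOp K t (-a)) {u v : ℝ → ℂ}
    (hu : SolvesIntegralEq K t a u) (hv : SolvesIntegralEq K t a v) : u = v := by
  refine sub_eq_zero.mp (eq_zero_of_homogeneous (D := u - v) hK h ha hn (fun x => ?_) fun x => ?_)
  · simp only [Pi.sub_apply, mul_sub]
    exact (hu x).1.sub (hv x).1
  · have := integral_sub (hu x).1 (hv x).1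
    simp only [Pi.sub_apply, mul_sub, this]
    linear_combination (hu x).2 - (hv x).2

/-- A solution on `[-t, t)` extends to a solution on the real line. -/
theorem exists_solvesIntegralEq (hK : Continuous K) (h : VanishesOnNegatives K) {a : ℝ}
    {φ : ℝ → ℝ} (hφ : Continuous φ)
    (heq : ∀ x ∈ Ico (-t) t, φ x + ∫ z in Ico (-t) t, a * K (x + z) * φ z = 1) :
    ∃ u : ℝ → ℂ, SolvesIntegralEq K t a u ∧
      u t = ((1 - ∫ z in Ico (-t) t, a * K (t + z) * φ z : ℝ) : ℂ) := by
  -- Below `-t` the integral vanishes, which forces the value `1`; applying the equation once to `v`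
  -- defines `u` also from `t` onwards.
  let v : ℝ → ℂ := fun y => if y < -t then 1 else (φ y : ℂ)
  let u : ℝ → ℂ := fun x => 1 - a * ∫ y in Iio t, (K (x + y) : ℂ) * v y
  have hreal : ∀ x ≤ t, u x = ((1 - ∫ z in Ico (-t) t, a * K (x + z) * φ z : ℝ) : ℂ) := by
    intro x hx
    simp only [u]
    rw [setIntegral_Iio_eq h hx, setIntegral_congr_fun (g := fun y => ((K (x + y) * φ y : ℝ) : ℂ))
      measurableSet_Ico fun y hy => ?_, integral_complex_ofReal]
    · simp only [mul_assoc, integral_const_mul]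
      push_cast
      rfl
    · simp [v, not_lt.mpr hy.1]
  have huv : ∀ x < t, u x = v x := by
    intro x hx
    by_cases hxt : x < -t
    · simp only [u]
      rw [setIntegral_Iio_eq_zero h hxt.le]
      simp [v, hxt]
    · rw [hreal x hx.le, ← heq x ⟨not_lt.mp hxt, hx⟩]
      simp [v, hxt]
  have hvint : ∀ c, IntegrableOn v (Icc c t) := by
    intro c
    have h1 : IntegrableOn (fun _ : ℝ => (1 : ℂ)) (Icc c t) := integrableOn_const (by simp)
    have h2 : IntegrableOn (fun y => (φ y : ℂ)) (Icc c t) :=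
      (Complex.continuous_ofReal.comp hφ).continuousOn.integrableOn_Icc
    exact Integrable.piecewise (s := Iio (-t)) measurableSet_Iio h1.integrableOn h2.integrableOn
  refine ⟨u, fun x => ?_, hreal t le_rfl⟩
  have hset : EqOn (fun y => (K (x + y) : ℂ) * v y) (fun y => (K (x + y) : ℂ) * u y) (Iio t) :=
    fun y hy => by simp only [huv y hy]
  refine ⟨(integrableOn_Iio_kernel_mul hK h x (hvint (-x))).congr_fun hset measurableSet_Iio, ?_⟩
  rw [← setIntegral_congr_fun measurableSet_Iio hset]
  simp [u]

/-- `det (1 - K[t]) = φ(t) det (1 + K[t])` if `φ` solves `φ + K[t] φ = 1`. -/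
theorem fredholmDet_neg_eq_mul (hK : Continuous K) (hK0 : ∀ x ≤ 0, K x = 0) (ht : 0 < t)
    {φ : ℝ → ℝ} (hφ : Continuous φ)
    (heq : ∀ x ∈ Icc (-t) t, φ x + ∫ z in Ico (-t) t, K (x + z) * φ z = 1) :
    fredholmDet (fun x y => -K (x + y)) (Ico (-t) t) 1 =
      φ t * fredholmDet (fun x y => K (x + y)) (Ico (-t) t) 1 := by
  have hB : Continuous (Function.uncurry fun x y : ℝ => -K (x + t) * φ y) :=
    ((hK.comp (continuous_fst.add continuous_const)).neg).mul (hφ.comp continuous_snd)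
  rw [fredholmDet_neg_sumKernel hK hK0 ht]
  -- The rank one determinant is `1 - ∫ K(x + t) φ(x) dx`, which is `φ t` by the equation at `x =
  -- t`.
  have hrank : fredholmDet (fun x y => -K (x + t) * φ y) (Ico (-t) t) 1 = φ t := by
    rw [fredholmDet_rank_one (fun x => -K (x + t)) φ, ← heq t ⟨by linarith, le_rfl⟩]
    simp only [neg_mul, integral_neg, add_comm t]
    ring
  rw [← hrank, ← fredholmDet_kernelMul (by linarith) hB (continuous_uncurry_add hK)]
  refine fredholmDet_congr measurableSet_Ico (fun x hx y hy => ?_) 1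
  have hy' := heq y (Ico_subset_Icc_self hy)
  have hint : ∫ z in Ico (-t) t, -K (x + t) * φ z * K (z + y) =
      -K (x + t) * ∫ z in Ico (-t) t, K (y + z) * φ z := by
    rw [← integral_const_mul]
    congr 1
    funext z
    rw [add_comm z y]
    ring
  rw [kernelMul, hint]
  linear_combination K (x + t) * hy'

/-- Existence of solutions, with the value at `t`, and the relation between the determinants. -/
theorem exists_solution_and_fredholmDet (hK : Continuous K) (h : VanishesOnNegatives K) {a : ℝ}
    (ha : a * a = 1) (hn : ¬ IsEigenvalueOfTruncatedOp K t (-(a : ℂ))) :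
    fredholmDet (sumKernel K) (Iio t) a ≠ 0 ∧ ∃ (u : ℝ → ℂ) (r : ℝ), SolvesIntegralEq K t a u ∧
      u t = r ∧ fredholmDet (sumKernel K) (Iio t) (-a) =
        r * fredholmDet (sumKernel K) (Iio t) a := by
  rcases le_or_gt t 0 with ht | ht
  · have hempty : Ico (-t) t = ∅ := Ico_eq_empty (by linarith)
    have hdet : ∀ c, fredholmDet (sumKernel K) (Iio t) c = 1 := by
      intro c
      rw [fredholmDet_sumKernel_Iio h, hempty]
      exact (fredholmDet_congr MeasurableSet.empty (by simp) 1).trans (fredholmDet_zero ∅)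
    obtain ⟨u, hu, hut⟩ := exists_solvesIntegralEq (t := t) (a := a) (φ := fun _ => 0) hK h
      continuous_const (by simp [hempty])
    exact ⟨by simp [hdet], u, _, hu, hut, by simp [hdet]⟩
  · have hab : -t < t := by linarith
    have haK : Continuous fun x => a * K x := continuous_const.mul hK
    have hk := continuous_uncurry_add haK
    obtain ⟨hne, φ, hφ, heq⟩ := fredholmDet_ne_zero_and_exists_solution hab hk
      (eq_zero_of_continuous_of_not_isEigenvalue h ht ha hn)
    obtain ⟨u, hu, hut⟩ := exists_solvesIntegralEq (a := a) hK h hφ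
      fun x hx => heq x (Ico_subset_Icc_self hx)
    have hφt := heq t ⟨by linarith, le_rfl⟩
    refine ⟨by rwa [fredholmDet_sumKernel_Iio h], u, φ t, hu, ?_, ?_⟩
    · rw [hut, ← hφt]
      simp
    · rw [fredholmDet_sumKernel_Iio h, fredholmDet_sumKernel_Iio h,
        ← fredholmDet_neg_eq_mul haK (fun x hx => by simp [h.eq_zero_of_nonpos hK hx]) ht hφ heq]
      simp only [neg_mul]

end SumKernel

/-! ### The theorem: the signs `a = 1` and `a = -1` combined. -/

theorem theorem1p4 (E : ℂ → ℂ) (c : ℝ) (K : ℝ → ℝ) (τ : EReal)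
    (hK2 : IsFourierKernel E c K)
    (hK3 : VanishesOnNegatives K)
    (hK4 : IsC1OutsideDiscrete K)
    (hK5 : NoUnitEigenvalueBelow K τ)
    (t : ℝ) (ht : (t : EReal) < τ) :
    (FredholmConverges (sumKernel K) (Iio t) 1 ∧
      FredholmConverges (sumKernel K) (Iio t) (-1) ∧
      fredholmDet (sumKernel K) (Iio t) (-1) ≠ 0) ∧
    (∃! Φ : ℝ → ℂ, SolvesIntegralEq K t 1 Φ) ∧
    (∃! Ψ : ℝ → ℂ, SolvesIntegralEq K t (-1) Ψ) ∧
    ∀ Φ Ψ : ℝ → ℂ, SolvesIntegralEq K t 1 Φ → SolvesIntegralEq K t (-1) Ψ →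
      Φ t ≠ 0 ∧ (detRatio K t : ℂ) = 1 / Φ t ∧ (detRatio K t : ℂ) = Ψ t := by
  have hK := hK2.continuous
  have hn1 : ¬ IsEigenvalueOfTruncatedOp K t 1 := by
    rcases le_or_gt 0 t with h | h
    · exact hK5.not_one t h ht
    · exact not_isEigenvalueOfTruncatedOp_of_neg hK3 h.le one_ne_zero
  have hn2 : ¬ IsEigenvalueOfTruncatedOp K t (-1) := by
    rcases le_or_gt 0 t with h | h
    · exact hK5.not_neg_one t h ht
    · exact not_isEigenvalueOfTruncatedOp_of_neg hK3 h.le (neg_ne_zero.mpr one_ne_zero)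
  -- The signs cross: `1 + K[t]` is injective because `-1` is not an eigenvalue, and `1 - K[t]`
  -- because `1` is not.
  obtain ⟨hd1, Φ₀, r, hΦ₀, hΦt, hr⟩ :=
    exists_solution_and_fredholmDet (a := 1) hK hK3 (by norm_num) (by simpa using hn2)
  obtain ⟨hd2, Ψ₀, q, hΨ₀, hΨt, hq⟩ :=
    exists_solution_and_fredholmDet (a := -1) hK hK3 (by norm_num) (by simpa using hn1)
  rw [neg_neg] at hq
  simp only [Complex.ofReal_neg, Complex.ofReal_one] at hΦ₀ hΨ₀
  have huΦ : ∀ Φ, SolvesIntegralEq K t 1 Φ → Φ = Φ₀ := fun Φ hΦ =>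
    hΦ.unique hK hK3 (by norm_num) hn2 hΦ₀
  have huΨ : ∀ Ψ, SolvesIntegralEq K t (-1) Ψ → Ψ = Ψ₀ := fun Ψ hΨ =>
    hΨ.unique hK hK3 (by norm_num) (by simpa using hn1) hΨ₀
  refine ⟨⟨fredholmConverges_sumKernel hK hK3 1, fredholmConverges_sumKernel hK hK3 (-1), hd2⟩,
    ⟨Φ₀, hΦ₀, huΦ⟩, ⟨Ψ₀, hΨ₀, huΨ⟩, fun Φ Ψ hΦ hΨ => ?_⟩
  rw [huΦ Φ hΦ, huΨ Ψ hΨ, hΦt, hΨt]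
  have hr0 : r ≠ 0 := fun h0 => hd2 (by rw [hr, h0, zero_mul])
  refine ⟨by exact_mod_cast hr0, ?_, ?_⟩
  · have : detRatio K t = 1 / r := by
      rw [detRatio, hr, div_eq_div_iff (mul_ne_zero hr0 hd1) hr0]
      ring
    rw [this]
    push_cast
    rfl
  · have : detRatio K t = q := by rw [detRatio, hq, mul_div_cancel_right₀ _ hd2]
    rw [this]
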